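/- Let $n\ge 2$ be an integer, let $d$ be an odd, positive, square-free integer, and let $S=\mathrm{diag}(1,\ldots,1,-d)$ be the $(n+1)\times(n+1)$ diagonal matrix of the quadratic form $x_1^2+\cdots+x_n^2-d\,x_{n+1}^2$. Let $E_8(S)$ be the number of $(n+1)\times(n+1)$ matrices $A$ over $\mathbb{Z}/8\mathbb{Z}$ such that $A^tSA=S$ over $\mathbb{Z}/8\mathbb{Z}$. Let $\epsilon_2(k)=1$ if $k$ is even and $\epsilon_2(k)=0$ if $k$ is odd, and define $$\alpha(n)=\prod_{k=1}^n\left(2^k-\epsilon_2(k)\right),\qquad \beta(n)=2^{n-2}+2^{(n-2)/2}\cos(n\pi/4),\qquad \gamma(n)=2^n+2^{n/2}\cos(n\pi/4).$$ Then $$E_8(S)=\begin{cases}2^{n^2+2n+2}\,\alpha(n)/\beta(n+1) & \text{if } d\equiv -1 \bmod 4,\\ 2^{n^2+2n+2}\,\alpha(n)/\gamma(n-1) & \text{if } d\equiv 1 \bmod 4.\end{cases}$$ -/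

import Mathlib

/-- The number `E_q(S)` of matrices `A` over `ℤ/qℤ` with `Aᵀ S A = S`, where the integral
matrix `S` is read modulo `q`. -/
noncomputable def unitCount (q : ℕ) {m : ℕ} (S : Matrix (Fin m) (Fin m) ℤ) : ℕ :=
  Nat.card {A : Matrix (Fin m) (Fin m) (ZMod q) //
    A.transpose * S.map (fun x : ℤ => (x : ZMod q)) * A = S.map (fun x : ℤ => (x : ZMod q))}

/-- The `(n+1) × (n+1)` diagonal matrix `diag(1, …, 1, -d)`, the matrix of the quadratic form
`x₁² + ⋯ + xₙ² - d xₙ₊₁²`. -/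
def formMatrix (n d : ℕ) : Matrix (Fin (n + 1)) (Fin (n + 1)) ℤ :=
  Matrix.diagonal (fun i => if i = Fin.last n then -(d : ℤ) else 1)

/-- `ε₂(k)` is `1` if `k` is even and `0` if `k` is odd. -/
def epsTwo (k : ℕ) : ℕ := if Even k then 1 else 0

/-- `α(n) = ∏_{k=1}^n (2^k - ε₂(k))`. -/
noncomputable def alphaProd (n : ℕ) : ℝ :=
  ∏ k ∈ Finset.Icc 1 n, ((2 : ℝ) ^ k - (epsTwo k : ℝ))

/-- `β(x) = 2^(x-2) + 2^((x-2)/2) cos(xπ/4)`, with real exponents. -/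
noncomputable def betaFun (x : ℝ) : ℝ :=
  (2 : ℝ) ^ (x - 2) + (2 : ℝ) ^ ((x - 2) / 2) * Real.cos (x * Real.pi / 4)

/-- `γ(x) = 2^x + 2^(x/2) cos(xπ/4)`, with real exponents. -/
noncomputable def gammaFun (x : ℝ) : ℝ :=
  (2 : ℝ) ^ x + (2 : ℝ) ^ (x / 2) * Real.cos (x * Real.pi / 4)

/-!
Put `m = n + 1`. The proof is one application of the orbit-stabilizer theorem. Let `P` be the group
of matrices over `ℤ/8` whose reduction over `𝔽₂` is orthogonal for the dot product
(`orthogonalLift`). It acts by `g • T = g T gᵀ` on the symmetric matrices `T` over `ℤ/8` that reduce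
to the identity over `𝔽₂` (`IsOddForm`). The matrix `S` of the form is one of these because `d` is
odd, and `E₈(S)` is the order of its stabilizer, so `E₈(S) = |P| / |P • S|`.

* Reduction makes `|P| = 4 ^ (m ^ 2) * |O_m(𝔽₂)|`, and `|O_m(𝔽₂)| = α(m - 1)`
  (`card_orthogonal_zmod_two`): transvections move the first basis vector to every vector of odd
  weight other than the all-ones vector, and its stabilizer is `O_{m-1}(𝔽₂)`.
* The orbit of `T` is determined by two invariants (`IsOddForm.formRel_iff`): the number, modulo 4,
  of diagonal entries `≡ -1 mod 4`, and the sum `𝟙ᵀ T 𝟙` of all entries. The first one is invariant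
  because the Gauss sum `∑ x, I ^ (xᵀ T x)` is `(4 (1 + I)) ^ m * (-I) ^ w` when there are `w` such
  entries; the second one because `gᵀ 𝟙` has odd coordinates. Conversely, a transvection along four
  basis vectors changes four signs at a time, permutations of the basis move the signs, and
  matrices that are `1` modulo 2 correct all the rest.
* Hence the orbit of `S` has `2 ^ (m ^ 2 - 1) * c` elements (`card_isOddForm`,
  `two_mul_card_formRel`), where `c` is the number of subsets of an `m`-element set whose size is
  congruent modulo 4 to the number of diagonal entries of `S` that are `≡ -1 mod 4`. That number is
  `0` if `d ≡ -1 mod 4` and `1` if `d ≡ 1 mod 4`, and `c` is then `β(n + 1)` or `γ(n - 1)`, by the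
  recursion of Pascal's triangle (`four_mul_sum_powerset`).
-/

open Matrix

/-! ### Orbits and stabilizers of congruence -/

/-- Orbit-stabilizer for a map `f` that is constant exactly on the left cosets of `H`. -/
theorem card_eq_card_range_mul_card_subgroup {G X : Type*} [Group G] (H : Subgroup G) (f : G → X)
    (hf : ∀ g h, f g = f h ↔ g⁻¹ * h ∈ H) :
    Nat.card G = Nat.card (Set.range f) * Nat.card H := by
  rw [Subgroup.card_eq_card_quotient_mul_card_subgroup H]
  congr 1
  have hker : QuotientGroup.leftRel H = Setoid.ker f := by
    ext g h
    rw [QuotientGroup.leftRel_apply]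
    exact (hf g h).symm
  change Nat.card (Quotient (QuotientGroup.leftRel H)) = _
  rw [hker]
  exact Nat.card_congr (Setoid.quotientKerEquivRange f)

/-- The isometry group of `S`, as the stabilizer of `S` under the left action `g • S = g S gᵀ`. -/
def congrStabilizer {ι R : Type*} [Fintype ι] [DecidableEq ι] [CommRing R] (S : Matrix ι ι R) :
    Subgroup (GL ι R) where
  carrier := {g | (g : Matrix ι ι R) * S * (g : Matrix ι ι R)ᵀ = S}
  one_mem' := by simp
  mul_mem' := by
    intro a b ha hb
    simp only [Set.mem_ofPred_eq] at *
    calc _ = (a : Matrix ι ι R) * ((b : Matrix ι ι R) * S * (b : Matrix ι ι R)ᵀ)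
            * (a : Matrix ι ι R)ᵀ := by
          simp only [Units.val_mul, transpose_mul, Matrix.mul_assoc]
      _ = S := by rw [hb, ha]
  inv_mem' := by
    intro a ha
    simp only [Set.mem_ofPred_eq] at *
    have h1 : (↑a⁻¹ : Matrix ι ι R) * (a : Matrix ι ι R) = 1 := a.inv_mul
    have h2 : (a : Matrix ι ι R)ᵀ * (↑a⁻¹ : Matrix ι ι R)ᵀ = 1 := by
      rw [← transpose_mul, h1, transpose_one]
    calc _ = (↑a⁻¹ : Matrix ι ι R) * ((a : Matrix ι ι R) * S * (a : Matrix ι ι R)ᵀ)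
            * (↑a⁻¹ : Matrix ι ι R)ᵀ := by rw [ha]
      _ = ((↑a⁻¹ : Matrix ι ι R) * (a : Matrix ι ι R)) * S
            * ((a : Matrix ι ι R)ᵀ * (↑a⁻¹ : Matrix ι ι R)ᵀ) := by
          simp only [Matrix.mul_assoc]
      _ = S := by rw [h1, h2, Matrix.one_mul, Matrix.mul_one]

section
variable {ι R : Type*} [Fintype ι] [DecidableEq ι] [CommRing R]

theorem mem_congrStabilizer {S : Matrix ι ι R} {g : GL ι R} :
    g ∈ congrStabilizer S ↔ (g : Matrix ι ι R) * S * (g : Matrix ι ι R)ᵀ = S := Iff.rfl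

theorem mem_congrStabilizer_one {g : GL ι R} :
    g ∈ congrStabilizer (1 : Matrix ι ι R) ↔ (g : Matrix ι ι R) * (g : Matrix ι ι R)ᵀ = 1 := by
  rw [mem_congrStabilizer, Matrix.mul_one]

/-- An invertible form only has invertible isometries, so that they may be counted as
matrices; transposition passes between the two conventions `Aᵀ S A` and `A S Aᵀ`. -/
theorem card_transpose_mul_mul_eq {S : Matrix ι ι R} (hS : IsUnit S.det) :
    Nat.card {A : Matrix ι ι R // Aᵀ * S * A = S} = Nat.card (congrStabilizer S) := by
  symm
  refine Nat.card_eq_of_bijective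
    (fun g => ⟨((g : GL ι R) : Matrix ι ι R)ᵀ, by
      rw [transpose_transpose]; exact g.2⟩) ⟨?_, ?_⟩
  · intro g h hgh
    exact Subtype.ext (Units.ext (transpose_injective (Subtype.ext_iff.mp hgh)))
  · rintro ⟨A, hA⟩
    have hdet : IsUnit A.det := by
      have h := congrArg det hA
      rw [det_mul] at h
      exact isUnit_of_mul_isUnit_right (h ▸ hS)
    refine ⟨⟨(Matrix.nonsingInvUnit Aᵀ (by rwa [det_transpose])), ?_⟩, ?_⟩
    · rw [mem_congrStabilizer]
      change Aᵀ * S * Aᵀᵀ = S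
      rwa [transpose_transpose]
    · exact Subtype.ext (transpose_transpose A)

end

/-! ### The orthogonal group over the field with two elements -/

/-- The orthogonal group of the standard dot product over `𝔽₂`. -/
abbrev orthogonalGroupTwo (ι : Type*) [Fintype ι] [DecidableEq ι] : Subgroup (GL ι (ZMod 2)) :=
  congrStabilizer 1

section
variable {ι : Type*} [Fintype ι] [DecidableEq ι]

theorem zmod_two_mul_self (a : ZMod 2) : a * a = a := by revert a; decide

theorem zmod_two_add_self (a : ZMod 2) : a + a = 0 := by revert a; decide

/-- Over `𝔽₂` an orthogonal matrix fixes the all-ones vector, since `x ⬝ x = x ⬝ 𝟙`. -/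
theorem mulVec_one_of_mul_transpose_eq_one {g : Matrix ι ι (ZMod 2)} (hg : g * gᵀ = 1) :
    g *ᵥ 1 = 1 := by
  ext i
  have h := congrFun (congrFun hg i) i
  rw [mul_apply] at h
  simpa [mulVec, dotProduct, zmod_two_mul_self] using h

theorem transvection_mul_transpose {u : ι → ZMod 2} (hu : ∑ i, u i = 0) :
    (1 + vecMulVec u u) * (1 + vecMulVec u u)ᵀ = 1 := by
  have huu : u ⬝ᵥ u = 0 := by simpa [dotProduct, zmod_two_mul_self] using hu
  rw [transpose_add, transpose_one, transpose_vecMulVec, Matrix.add_mul, Matrix.one_mul,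
    Matrix.mul_add, Matrix.mul_one, vecMulVec_mul_vecMulVec, huu]
  ext i j
  simp [add_assoc, zmod_two_add_self]

/-- The transvection `x ↦ x + (x ⬝ u) u` along a vector `u` of even weight, which is
self-orthogonal. -/
def transvectionUnit (u : ι → ZMod 2) (hu : ∑ i, u i = 0) :
    orthogonalGroupTwo ι :=
  ⟨⟨1 + vecMulVec u u, (1 + vecMulVec u u)ᵀ, transvection_mul_transpose hu, by
    have h := transvection_mul_transpose hu
    exact mul_eq_one_comm.mp h⟩, mem_congrStabilizer_one.mpr (transvection_mul_transpose hu)⟩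

/-- Two vectors of odd weight that are orthogonal to each other are exchanged by a transvection. -/
theorem exists_mulVec_eq_of_dotProduct_eq_zero {v w : ι → ZMod 2} (hv : ∑ i, v i = 1)
    (hw : ∑ i, w i = 1) (hvw : v ⬝ᵥ w = 0) :
    ∃ g ∈ orthogonalGroupTwo ι, (g : Matrix ι ι (ZMod 2)) *ᵥ v = w := by
  have hu : ∑ i, (v + w) i = 0 := by
    simp only [Pi.add_apply, Finset.sum_add_distrib, hv, hw]; decide
  refine ⟨_, (transvectionUnit (v + w) hu).2, ?_⟩
  change (1 + vecMulVec (v + w) (v + w)) *ᵥ v = w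
  have hvv : v ⬝ᵥ v = 1 := by simpa [dotProduct, zmod_two_mul_self] using hv
  have h1 : (v + w) ⬝ᵥ v = 1 := by
    rw [add_dotProduct, hvv, dotProduct_comm w v, hvw, add_zero]
  rw [add_mulVec, one_mulVec, vecMulVec_mulVec, h1]
  ext i
  simp [← add_assoc, zmod_two_add_self]

theorem exists_mulVec_single_eq (i₀ : ι) {v : ι → ZMod 2} (hv : ∑ i, v i = 1) (hv1 : v ≠ 1) :
    ∃ g ∈ orthogonalGroupTwo ι,
      (g : Matrix ι ι (ZMod 2)) *ᵥ Pi.single i₀ 1 = v := by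
  obtain ⟨j, hj⟩ : ∃ j, v j = 0 := by
    by_contra! h
    refine hv1 (funext fun j => ?_)
    have := h j
    change v j = 1
    revert this
    generalize v j = a
    revert a; decide
  by_cases h0 : v i₀ = 0
  · exact exists_mulVec_eq_of_dotProduct_eq_zero (by simp) hv (by simp [h0])
  · have hne : i₀ ≠ j := fun h => h0 (h ▸ hj)
    -- Two transvections are needed here, with the basis vector at `j` in between.
    obtain ⟨g, hg, hgv⟩ := exists_mulVec_eq_of_dotProduct_eq_zero
      (v := Pi.single i₀ 1) (w := Pi.single j 1) (by simp) (by simp) (by simp [hne])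
    obtain ⟨h, hh, hhv⟩ := exists_mulVec_eq_of_dotProduct_eq_zero
      (v := Pi.single j 1) (w := v) (by simp) hv (by simp [hj])
    refine ⟨h * g, mul_mem hh hg, ?_⟩
    rw [Units.val_mul, ← mulVec_mulVec, hgv, hhv]

end

/-- The block matrix `diag(1, B)`. -/
def consOne {m : ℕ} {R : Type*} [Zero R] [One R] (B : Matrix (Fin m) (Fin m) R) :
    Matrix (Fin (m + 1)) (Fin (m + 1)) R :=
  Matrix.of (Fin.cons (Fin.cons 1 0) fun i => Fin.cons 0 (B i))

section
variable {m : ℕ} {R : Type*} [CommRing R]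

@[simp] theorem consOne_zero_zero (B : Matrix (Fin m) (Fin m) R) : consOne B 0 0 = 1 := rfl
@[simp] theorem consOne_zero_succ (B : Matrix (Fin m) (Fin m) R) (j : Fin m) :
    consOne B 0 j.succ = 0 := rfl
@[simp] theorem consOne_succ_zero (B : Matrix (Fin m) (Fin m) R) (i : Fin m) :
    consOne B i.succ 0 = 0 := rfl
@[simp] theorem consOne_succ_succ (B : Matrix (Fin m) (Fin m) R) (i j : Fin m) :
    consOne B i.succ j.succ = B i j := rfl

theorem consOne_mul_transpose (B : Matrix (Fin m) (Fin m) R) :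
    consOne B * (consOne B)ᵀ = consOne (B * Bᵀ) := by
  ext i j
  refine Fin.cases ?_ (fun i => ?_) i <;> refine Fin.cases ?_ (fun j => ?_) j <;>
    simp [mul_apply, Fin.sum_univ_succ]

theorem consOne_one : consOne (1 : Matrix (Fin m) (Fin m) R) = 1 := by
  ext i j
  refine Fin.cases ?_ (fun i => ?_) i <;> refine Fin.cases ?_ (fun j => ?_) j <;>
    simp [one_apply, Fin.succ_ne_zero, (Fin.succ_ne_zero _).symm]

theorem consOne_injective : Function.Injective (consOne : Matrix (Fin m) (Fin m) R → _) :=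
  fun B C h => by
    ext i j
    simpa using congrFun (congrFun h i.succ) j.succ

/-- An orthogonal matrix whose first column is the first basis vector has the block form
`diag(1, B)`. -/
theorem exists_consOne_eq {g : Matrix (Fin (m + 1)) (Fin (m + 1)) R} (hg : g * gᵀ = 1)
    (h0 : g *ᵥ Pi.single 0 1 = Pi.single 0 1) : ∃ B, consOne B = g := by
  have hcol : ∀ i, g i 0 = (Pi.single 0 1 : Fin (m + 1) → R) i := fun i => by
    rw [← h0]; simp
  have hrow : ∀ j, g 0 j = (Pi.single 0 1 : Fin (m + 1) → R) j := fun j => by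
    have hg' : gᵀ * g = 1 := mul_eq_one_comm.mp hg
    have h := congrFun (congrFun hg' 0) j
    rw [mul_apply] at h
    simp only [transpose_apply, hcol] at h
    rw [Finset.sum_eq_single 0 (by intro b _ hb; simp [hb]) (by simp)] at h
    simpa [one_apply, Pi.single_apply, eq_comm] using h
  refine ⟨Matrix.of fun i j => g i.succ j.succ, ?_⟩
  ext i j
  refine Fin.cases ?_ (fun i => ?_) i
  · refine Fin.cases ?_ (fun j => ?_) j <;> simp [hrow]
  · refine Fin.cases ?_ (fun j => ?_) j <;> simp [hcol]

end

/-- The stabilizer of the first basis vector in the orthogonal group over `𝔽₂`. -/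
def basisStabilizer (m : ℕ) : Subgroup (orthogonalGroupTwo (Fin (m + 1))) where
  carrier := {g | g.1.val *ᵥ Pi.single 0 1 = Pi.single 0 1}
  one_mem' := one_mulVec _
  mul_mem' := by
    intro a b ha hb
    simp only [Set.mem_ofPred_eq] at *
    rw [Subgroup.coe_mul, Units.val_mul, ← mulVec_mulVec, hb, ha]
  inv_mem' := by
    intro a ha
    simp only [Set.mem_ofPred_eq] at *
    conv_lhs => rw [← ha]
    rw [mulVec_mulVec, Subgroup.coe_inv, Units.inv_mul, one_mulVec]

theorem card_basisStabilizer (m : ℕ) :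
    Nat.card (basisStabilizer m) = Nat.card (orthogonalGroupTwo (Fin m)) := by
  symm
  have key (B : GL (Fin m) (ZMod 2)) (hB : B ∈ orthogonalGroupTwo (Fin m)) :
      consOne B.val * (consOne B.val)ᵀ = 1 := by
    rw [consOne_mul_transpose, mem_congrStabilizer_one.mp hB, consOne_one]
  refine Nat.card_eq_of_bijective (fun B => ⟨⟨⟨consOne B.1.val, (consOne B.1.val)ᵀ, key B B.2,
    mul_eq_one_comm.mp (key B B.2)⟩, mem_congrStabilizer_one.mpr (key B B.2)⟩, ?_⟩) ⟨?_, ?_⟩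
  · change consOne _ *ᵥ Pi.single 0 1 = Pi.single 0 1
    ext i
    refine Fin.cases ?_ (fun i => ?_) i <;> simp
  · intro B C h
    have h1 := congrArg (fun x : basisStabilizer m => x.1.1.val) h
    exact Subtype.ext (Units.ext (consOne_injective h1))
  · rintro ⟨⟨g, hg⟩, hs⟩
    obtain ⟨B, hB⟩ := exists_consOne_eq (mem_congrStabilizer_one.mp hg) hs
    have hBB : B * Bᵀ = 1 := consOne_injective (by
      rw [← consOne_mul_transpose, hB, consOne_one]; exact mem_congrStabilizer_one.mp hg)
    exact ⟨⟨⟨B, Bᵀ, hBB, mul_eq_one_comm.mp hBB⟩, mem_congrStabilizer_one.mpr hBB⟩,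
      Subtype.ext (Subtype.ext (Units.ext hB))⟩

theorem card_sum_eq_one (m : ℕ) :
    Nat.card {v : Fin (m + 1) → ZMod 2 // ∑ i, v i = 1} = 2 ^ m := by
  have : Nat.card (Fin m → ZMod 2) = 2 ^ m := by simp
  rw [← this]
  refine Nat.card_eq_of_bijective (fun v i => v.1 i.succ) ⟨?_, ?_⟩
  · rintro ⟨v, hv⟩ ⟨w, hw⟩ h
    have h' : ∀ i : Fin m, v i.succ = w i.succ := fun i => congrFun h i
    rw [Fin.sum_univ_succ] at hv hw
    refine Subtype.ext (funext (Fin.cases ?_ h'))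
    simp only [h'] at hv
    exact add_right_cancel (hv.trans hw.symm)
  · intro w
    exact ⟨⟨Fin.cons (1 - ∑ i, w i) w, by simp [Fin.sum_univ_succ]⟩, by ext i; simp⟩

/-- The all-ones vector of length `m + 1` has odd weight exactly for even `m`; this is where `ε₂`
comes from. -/
theorem card_sum_eq_one_ne_one (m : ℕ) :
    (Nat.card {v : Fin (m + 1) → ZMod 2 // ∑ i, v i = 1 ∧ v ≠ 1} : ℝ) = 2 ^ m - epsTwo m := by
  classical
  have h := card_sum_eq_one m
  rw [Nat.card_eq_fintype_card, Fintype.card_subtype] at h ⊢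
  rw [← Finset.filter_filter, Finset.filter_ne']
  have hs : (∑ _i : Fin (m + 1), (1 : ZMod 2)) = 1 ↔ Even m := by
    rw [Finset.sum_const, Finset.card_univ, Fintype.card_fin, nsmul_eq_mul, mul_one, Nat.cast_succ,
      add_eq_right, ZMod.natCast_eq_zero_iff_even]
  by_cases hm : Even m
  · rw [Finset.card_erase_of_mem (by simpa using hs.mpr hm), h, epsTwo, if_pos hm,
      Nat.cast_sub Nat.one_le_two_pow]
    simp
  · rw [Finset.erase_eq_of_notMem (by simpa using fun h => hm (hs.mp (by simpa using h))), h,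
      epsTwo, if_neg hm]
    simp

theorem card_orthogonal_zmod_two (n : ℕ) :
    (Nat.card (orthogonalGroupTwo (Fin (n + 1))) : ℝ)
      = alphaProd n := by
  induction n with
  | zero =>
    have : Nat.card (orthogonalGroupTwo (Fin 1)) = 1 := by
      rw [Nat.card_eq_one_iff_unique]
      refine ⟨⟨fun g h => ?_⟩, ⟨1⟩⟩
      refine Subtype.ext (Units.ext ?_)
      have key (g : orthogonalGroupTwo (Fin 1)) :
          g.1.val = 1 := by
        have h1 := mulVec_one_of_mul_transpose_eq_one (mem_congrStabilizer_one.mp g.2)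
        ext i j
        have := congrFun h1 i
        fin_cases i; fin_cases j
        simpa [mulVec, dotProduct] using this
      rw [key g, key h]
    simp [this, alphaProd]
  | succ n ih =>
    rw [card_eq_card_range_mul_card_subgroup (basisStabilizer (n + 1))
      (fun g => g.1.val *ᵥ Pi.single 0 1) ?_, card_basisStabilizer,
      Nat.cast_mul, ih]
    · have : Set.range (fun g : orthogonalGroupTwo (Fin (n + 1 + 1)) => g.1.val *ᵥ Pi.single 0 1)
          = {v | ∑ i, v i = 1 ∧ v ≠ 1} := by
        ext v
        constructor
        · rintro ⟨g, rfl⟩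
          have hg := mem_congrStabilizer_one.mp g.2
          have hg' := mul_eq_one_comm.mp hg
          constructor
          · have h := congrFun (congrFun hg' 0) 0
            rw [mul_apply] at h
            simpa [zmod_two_mul_self] using h
          · intro h
            have h2 := h.trans (mulVec_one_of_mul_transpose_eq_one hg).symm
            have h3 := congrArg (fun x => g.1.valᵀ *ᵥ x) h2
            simp only [mulVec_mulVec, hg', one_mulVec] at h3
            simpa using congrFun h3 1
        · rintro ⟨h1, h2⟩
          obtain ⟨g, hg, hv⟩ := exists_mulVec_single_eq 0 h1 h2
          exact ⟨⟨g, hg⟩, hv⟩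
      rw [this]
      have h2 := card_sum_eq_one_ne_one (n + 1)
      simp only [Set.coe_ofPred]
      rw [h2, alphaProd, alphaProd, Finset.prod_Icc_succ_top (by omega), mul_comm]
    · intro g h
      change _ ↔ (g⁻¹ * h).1.val *ᵥ Pi.single 0 1 = Pi.single 0 1
      rw [Subgroup.coe_mul, Units.val_mul, ← mulVec_mulVec, Subgroup.coe_inv]
      constructor
      · intro e
        rw [← e, mulVec_mulVec, Units.inv_mul, one_mulVec]
      · intro e
        have := congrArg (fun x => g.1.val *ᵥ x) e
        simp only [mulVec_mulVec, ← Matrix.mul_assoc, Units.mul_inv, Matrix.one_mul] at this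
        exact this.symm

/-! ### Symmetric forms modulo 8 that reduce to the dot product -/

/-- Reduction from `ℤ/8` to `𝔽₂`. -/
def redTwo : ZMod 8 →+* ZMod 2 := ZMod.castHom (by decide) (ZMod 2)

theorem redTwo_eq_one {x : ZMod 8} : redTwo x = 1 ↔ x * x = 1 := by revert x; decide

theorem exists_eq_two_mul {x : ZMod 8} (h : redTwo x = 0) : x = 2 * (x.val / 2 : ℕ) := by
  revert x; decide

theorem exists_eq_four_mul {x : ZMod 8} (h : 2 * x = 0) : x = 4 * (x.val / 4 : ℕ) := by
  revert x; decide

section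
variable {ι : Type*} [DecidableEq ι]

/-- A symmetric matrix over `ℤ/8` that reduces to the identity matrix, that is to the standard dot
product, over `𝔽₂`. -/
structure IsOddForm (T : Matrix ι ι (ZMod 8)) : Prop where
  transpose_eq : Tᵀ = T
  map_eq : T.map redTwo = 1

namespace IsOddForm
variable {T : Matrix ι ι (ZMod 8)}

theorem redTwo_diag (hT : IsOddForm T) (i : ι) : redTwo (T i i) = 1 := by
  simpa using congrFun (congrFun hT.map_eq i) i

theorem redTwo_off_diag (hT : IsOddForm T) {i j : ι} (h : i ≠ j) : redTwo (T i j) = 0 := by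
  simpa [h] using congrFun (congrFun hT.map_eq i) j

theorem apply_comm (hT : IsOddForm T) (i j : ι) : T i j = T j i :=
  congrFun (congrFun hT.transpose_eq j) i

theorem exists_eq_one_add (hT : IsOddForm T) :
    ∃ W : Matrix ι ι (ZMod 8), Wᵀ = W ∧ T = 1 + (2 : ZMod 8) • W := by
  refine ⟨(T - 1).map fun x => ((x.val / 2 : ℕ) : ZMod 8), ?_, ?_⟩
  · rw [← transpose_map, transpose_sub, hT.transpose_eq, transpose_one]
  · have h : (T - 1).map redTwo = 0 := by
      rw [Matrix.map_sub _ (map_sub redTwo), hT.map_eq,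
        Matrix.map_one _ (map_zero _) (map_one _), sub_self]
    rw [← sub_eq_iff_eq_add']
    ext i j
    exact exists_eq_two_mul (congrFun (congrFun h i) j)

end IsOddForm

/-- A symmetric matrix is the sum of its diagonal, a strictly upper triangular matrix and the
transpose of the latter. Triangularity is not recorded in the conclusion. -/
theorem exists_eq_diagonal_add {R : Type*} [CommRing R] {Y : Matrix ι ι R}
    (hY : Yᵀ = Y) : ∃ U : Matrix ι ι R, Y = diagonal (fun i => Y i i) + (U + Uᵀ) := by
  obtain ⟨_⟩ := exists_wellFoundedLT ι
  refine ⟨Matrix.of fun i j => if i < j then Y i j else 0, ?_⟩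
  ext i j
  have h : Y j i = Y i j := congrFun (congrFun hY i) j
  rcases lt_trichotomy i j with hij | rfl | hij
  · simp [hij, hij.ne, hij.not_gt]
  · simp
  · simp [hij, hij.ne', hij.not_gt, h]

end

section
variable {ι : Type*} [Fintype ι]

/-- The sum `𝟙ᵀ T 𝟙` of all the entries of `T`. -/
def entrySum (T : Matrix ι ι (ZMod 8)) : ZMod 8 := 1 ⬝ᵥ T *ᵥ 1

/-- The indices `i` with `T i i ≡ -1 mod 4`. -/
def minusSet (T : Matrix ι ι (ZMod 8)) : Finset ι := {i | 2 * T i i = 6}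

theorem mem_minusSet {T : Matrix ι ι (ZMod 8)} {i : ι} : i ∈ minusSet T ↔ 2 * T i i = 6 := by
  simp [minusSet]

theorem dotProduct_congr_mulVec (g T : Matrix ι ι (ZMod 8)) (x : ι → ZMod 8) :
    x ⬝ᵥ (g * T * gᵀ) *ᵥ x = (gᵀ *ᵥ x) ⬝ᵥ T *ᵥ (gᵀ *ᵥ x) := by
  rw [← mulVec_mulVec, ← mulVec_mulVec, dotProduct_mulVec, ← mulVec_transpose]

end

section
variable {ι : Type*} [Fintype ι] [DecidableEq ι]

/-- Modulo 4 the quadratic form of an odd form is diagonal. -/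
theorem IsOddForm.exists_dotProduct_eq {T : Matrix ι ι (ZMod 8)}
    (hT : IsOddForm T) : ∃ V : Matrix ι ι (ZMod 8), ∀ x : ι → ZMod 8,
      x ⬝ᵥ T *ᵥ x = ∑ i, T i i * (x i * x i) + 4 * (x ⬝ᵥ V *ᵥ x) := by
  obtain ⟨W, hW, rfl⟩ := hT.exists_eq_one_add
  obtain ⟨U, hU⟩ := exists_eq_diagonal_add hW
  refine ⟨U, fun x => ?_⟩
  have h1 : x ⬝ᵥ Uᵀ *ᵥ x = x ⬝ᵥ U *ᵥ x := by
    rw [dotProduct_mulVec, vecMul_transpose, dotProduct_comm]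
  have h2 : x ⬝ᵥ diagonal (fun i => W i i) *ᵥ x = ∑ i, W i i * (x i * x i) := by
    simp only [dotProduct, mulVec_diagonal]
    exact Finset.sum_congr rfl fun i _ => by ring
  have h3 : x ⬝ᵥ W *ᵥ x = ∑ i, W i i * (x i * x i) + 2 * (x ⬝ᵥ U *ᵥ x) := by
    conv_lhs => rw [hU]
    rw [add_mulVec, add_mulVec, dotProduct_add, dotProduct_add, h1, h2]
    ring
  rw [add_mulVec, smul_mulVec, one_mulVec, dotProduct_add, dotProduct_smul, h3, smul_eq_mul,
    dotProduct]
  simp only [Matrix.add_apply, one_apply_eq, Matrix.smul_apply, smul_eq_mul, add_mul, one_mul,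
    Finset.sum_add_distrib, mul_assoc, ← Finset.mul_sum]
  ring

/-- The matrices over `ℤ/8` whose reduction over `𝔽₂` is orthogonal. -/
def orthogonalLift (ι : Type*) [Fintype ι] [DecidableEq ι] : Subgroup (GL ι (ZMod 8)) :=
  (orthogonalGroupTwo ι).comap (GeneralLinearGroup.map redTwo)

theorem mem_orthogonalLift {g : GL ι (ZMod 8)} :
    g ∈ orthogonalLift ι ↔ g.val.map redTwo * (g.val.map redTwo)ᵀ = 1 := by
  rw [orthogonalLift, Subgroup.mem_comap, mem_congrStabilizer_one]; rfl

theorem isUnit_of_map_redTwo {A : Matrix ι ι (ZMod 8)}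
    (hA : A.map redTwo * (A.map redTwo)ᵀ = 1) : IsUnit A := by
  rw [isUnit_iff_isUnit_det]
  have h : redTwo A.det ≠ 0 := by
    rw [RingHom.map_det]
    exact ((isUnit_iff_isUnit_det _).mp (IsUnit.of_mul_eq_one _ hA)).ne_zero
  have key : ∀ x : ZMod 8, redTwo x ≠ 0 → x * x = 1 := by decide
  exact IsUnit.of_mul_eq_one _ (key _ h)

/-- Congruence under `orthogonalLift`. -/
def FormRel (T T' : Matrix ι ι (ZMod 8)) : Prop :=
  ∃ g ∈ orthogonalLift ι, g.val * T * g.valᵀ = T'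

namespace FormRel
variable {T T' T'' : Matrix ι ι (ZMod 8)}

theorem of_matrix {A : Matrix ι ι (ZMod 8)}
    (hA : A.map redTwo * (A.map redTwo)ᵀ = 1) : FormRel T (A * T * Aᵀ) := by
  obtain ⟨g, rfl⟩ := isUnit_of_map_redTwo hA
  exact ⟨g, mem_orthogonalLift.mpr hA, rfl⟩

theorem symm (h : FormRel T T') : FormRel T' T := by
  obtain ⟨g, hg, rfl⟩ := h
  refine ⟨g⁻¹, inv_mem hg, ?_⟩
  have h2 : g.valᵀ * (↑g⁻¹ : Matrix ι ι (ZMod 8))ᵀ = 1 := by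
    rw [← transpose_mul, Units.inv_mul, transpose_one]
  calc _ = ((↑g⁻¹ : Matrix ι ι (ZMod 8)) * g.val) * T
        * (g.valᵀ * (↑g⁻¹ : Matrix ι ι (ZMod 8))ᵀ) := by simp only [Matrix.mul_assoc]
    _ = T := by rw [h2, Units.inv_mul, Matrix.one_mul, Matrix.mul_one]

theorem trans (h : FormRel T T') (h' : FormRel T' T'') : FormRel T T'' := by
  obtain ⟨g, hg, rfl⟩ := h
  obtain ⟨k, hk, rfl⟩ := h'
  exact ⟨k * g, mul_mem hk hg, by simp only [Units.val_mul, transpose_mul, Matrix.mul_assoc]⟩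

theorem isOddForm (h : FormRel T T') (hT : IsOddForm T) : IsOddForm T' := by
  obtain ⟨g, hg, rfl⟩ := h
  refine ⟨?_, ?_⟩
  · simp only [transpose_mul, transpose_transpose, hT.transpose_eq, Matrix.mul_assoc]
  · rw [Matrix.map_mul, Matrix.map_mul, hT.map_eq, Matrix.mul_one, transpose_map]
    exact mem_orthogonalLift.mp hg

/-- The all-ones vector is characteristic for the reduction over `𝔽₂`, hence is moved to a vector
with odd coordinates, and odd squares are `1` modulo 8. -/
theorem entrySum_eq (h : FormRel T T') (hT : IsOddForm T) :
    entrySum T' = entrySum T := by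
  obtain ⟨g, hg, rfl⟩ := h
  have hg' := mul_eq_one_comm.mp (mem_orthogonalLift.mp hg)
  have hodd : ∀ i, redTwo ((g.valᵀ *ᵥ 1) i) = 1 := fun i => by
    have h1 := congrFun (mulVec_one_of_mul_transpose_eq_one
      (g := (g.val.map redTwo)ᵀ) (by rwa [transpose_transpose])) i
    rw [RingHom.map_mulVec, transpose_map,
      show redTwo ∘ (1 : ι → ZMod 8) = 1 from funext fun _ => map_one redTwo]
    exact h1
  obtain ⟨V, hV⟩ := hT.exists_dotProduct_eq
  have hs : ∀ x : ι → ZMod 8, (∀ i, redTwo (x i) = 1) → x ⬝ᵥ T *ᵥ x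
      = ∑ i, T i i + ∑ i, ∑ j, 4 * V i j := by
    intro x hx
    have h4 : ∀ a b c : ZMod 8, redTwo a = 1 → redTwo b = 1 → 4 * (a * (c * b)) = 4 * c := by
      decide
    rw [hV x]
    simp only [redTwo_eq_one.mp (hx _), mul_one, dotProduct, mulVec, Finset.mul_sum,
      h4 _ _ _ (hx _) (hx _)]
  rw [entrySum, entrySum, dotProduct_congr_mulVec, hs _ hodd, hs 1 (by simp)]

end FormRel

/-- The character `z ↦ I ^ z` of `ℤ/8`. -/
noncomputable def chiI : AddChar (ZMod 8) ℂ :=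
  AddChar.zmodChar 8 (by rw [show 8 = 4 * 2 from rfl, pow_mul, Complex.I_pow_four, one_pow])

theorem chiI_four_mul (x : ZMod 8) : chiI (4 * x) = 1 := by
  rw [chiI, AddChar.zmodChar_apply]
  have h : ∀ x : ZMod 8, (4 * x).val = 0 ∨ (4 * x).val = 4 := by decide
  rcases h x with h | h <;> rw [h]
  · simp
  · exact Complex.I_pow_four

/-- The quadratic Gauss sum of `T` at the character `chiI`. -/
noncomputable def gaussSum8 (T : Matrix ι ι (ZMod 8)) : ℂ := ∑ x : ι → ZMod 8, chiI (x ⬝ᵥ T *ᵥ x)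

theorem FormRel.gaussSum8_eq {T T' : Matrix ι ι (ZMod 8)} (h : FormRel T T') :
    gaussSum8 T' = gaussSum8 T := by
  obtain ⟨g, -, rfl⟩ := h
  have h1 : (↑g⁻¹ : Matrix ι ι (ZMod 8))ᵀ * g.valᵀ = 1 := by
    rw [← transpose_mul, Units.mul_inv, transpose_one]
  refine Fintype.sum_bijective (fun x => g.valᵀ *ᵥ x) ?_ _ _ fun x => by
    rw [dotProduct_congr_mulVec]
  apply Finite.injective_iff_bijective.mp
  intro x y hxy
  have h2 := congrArg (fun z => (↑g⁻¹ : Matrix ι ι (ZMod 8))ᵀ *ᵥ z) hxy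
  simpa only [mulVec_mulVec, h1, one_mulVec] using h2

theorem sum_chiI_mul_sq {t : ZMod 8} (ht : redTwo t = 1) :
    ∑ a : ZMod 8, chiI (t * (a * a))
      = 4 * (1 + Complex.I) * (if 2 * t = 6 then -Complex.I else 1) := by
  have hI : Complex.I * Complex.I = -1 := Complex.I_mul_I
  have h : ∀ t : ZMod 8, redTwo t = 1 → t = 1 ∨ t = 3 ∨ t = 5 ∨ t = 7 := by decide
  have e : ∀ n : ℕ, Complex.I ^ (n + 4) = Complex.I ^ n := fun n => by
    rw [pow_add, Complex.I_pow_four, mul_one]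
  have hsum : ∀ f : ZMod 8 → ℂ, ∑ a, f a = f 0 + f 1 + f 2 + f 3 + f 4 + f 5 + f 6 + f 7 :=
    fun f => Fin.sum_univ_eight f
  have h0 : chiI 0 = 1 := AddChar.map_zero_eq_one _
  have h4 : chiI 4 = 1 := chiI_four_mul 1
  have h1 : chiI 1 = Complex.I := by
    rw [chiI, AddChar.zmodChar_apply]; exact pow_one _
  have h5 : chiI 5 = Complex.I := by
    rw [show (5 : ZMod 8) = 4 + 1 from rfl, AddChar.map_add_eq_mul, h4, h1, one_mul]
  have h3 : chiI 3 = -Complex.I := by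
    rw [show (3 : ZMod 8) = 1 + 1 + 1 from rfl, AddChar.map_add_eq_mul, AddChar.map_add_eq_mul, h1,
      hI, neg_one_mul]
  have h7 : chiI 7 = -Complex.I := by
    rw [show (7 : ZMod 8) = 4 + 3 from rfl, AddChar.map_add_eq_mul, h4, h3, one_mul]
  have hq : ∑ a : ZMod 8, chiI (t * (a * a)) = 4 + 4 * chiI t := by
    have ev : ∀ t a : ZMod 8, redTwo a = 0 → t * (a * a) = 4 * (t * (a.val / 2 : ℕ)) := by
      decide
    have od : ∀ t a : ZMod 8, redTwo a = 1 → t * (a * a) = t := by decide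
    rw [hsum, od t 1 rfl, od t 3 rfl, od t 5 rfl, od t 7 rfl, ev t 0 rfl, ev t 2 rfl, ev t 4 rfl,
      ev t 6 rfl]
    simp only [chiI_four_mul]
    ring
  rw [hq]
  rcases h t ht with rfl | rfl | rfl | rfl
  · rw [h1, if_neg (by decide)]; ring
  · rw [h3, if_pos (by decide)]; linear_combination 4 * hI
  · rw [h5, if_neg (by decide)]; ring
  · rw [h7, if_pos (by decide)]; linear_combination 4 * hI

/-- The Gauss sum splits into one factor per coordinate, as the character kills multiples of 4. -/
theorem IsOddForm.gaussSum8_eq {T : Matrix ι ι (ZMod 8)} (hT : IsOddForm T) :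
    gaussSum8 T = (4 * (1 + Complex.I)) ^ Fintype.card ι * (-Complex.I) ^ (minusSet T).card := by
  obtain ⟨V, hV⟩ := hT.exists_dotProduct_eq
  have h (x : ι → ZMod 8) : chiI (x ⬝ᵥ T *ᵥ x) = ∏ i, chiI (T i i * (x i * x i)) := by
    rw [hV, AddChar.map_add_eq_mul, chiI_four_mul, mul_one]
    exact map_prod chiI.toMonoidHom (fun i => Multiplicative.ofAdd (T i i * (x i * x i)))
      Finset.univ
  simp only [gaussSum8, h]
  rw [← Fintype.prod_sum (fun i (a : ZMod 8) => chiI (T i i * (a * a)))]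
  simp only [sum_chiI_mul_sq (hT.redTwo_diag _)]
  rw [Finset.prod_mul_distrib, Finset.prod_const, Finset.card_univ, Finset.prod_ite,
    Finset.prod_const, Finset.prod_const_one, mul_one]
  rfl

theorem FormRel.card_minusSet_modEq {T T' : Matrix ι ι (ZMod 8)}
    (h : FormRel T T') (hT : IsOddForm T) :
    (minusSet T').card ≡ (minusSet T).card [MOD 4] := by
  have h1 := h.gaussSum8_eq
  have hne : (4 * (1 + Complex.I)) ^ Fintype.card ι ≠ 0 := by
    refine pow_ne_zero _ (mul_ne_zero (by norm_num) fun h0 => ?_)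
    simpa using congrArg Complex.re h0
  rw [hT.gaussSum8_eq, (h.isOddForm hT).gaussSum8_eq, mul_right_inj' hne] at h1
  have hprim : IsPrimitiveRoot (-Complex.I) 4 := by
    refine (IsPrimitiveRoot.iff (by norm_num)).mpr
      ⟨by rw [neg_pow, Complex.I_pow_four]; norm_num, ?_⟩
    intro l hl0 hl h
    interval_cases l
    · simpa using congrArg Complex.re h
    · norm_num [neg_sq] at h
    · rw [neg_pow, Complex.I_pow_three] at h
      have := congrArg Complex.re h
      norm_num at this
  rw [hprim.isOfFinOrder (by norm_num) |>.pow_eq_pow_iff_modEq, ← hprim.eq_orderOf] at h1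
  exact h1

end

/-! ### Transitivity of congruence on forms with the same invariants -/

theorem eight_smul_eq_zero {ι : Type*} (X : Matrix ι ι (ZMod 8)) : (8 : ZMod 8) • X = 0 := by
  rw [show (8 : ZMod 8) = 0 from rfl, zero_smul]

section
variable {ι : Type*} [Fintype ι]

theorem entrySum_add (T T' : Matrix ι ι (ZMod 8)) :
    entrySum (T + T') = entrySum T + entrySum T' := by
  simp [entrySum, add_mulVec]

theorem entrySum_smul (a : ZMod 8) (T : Matrix ι ι (ZMod 8)) :
    entrySum (a • T) = a * entrySum T := by
  simp [entrySum, smul_mulVec]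

theorem entrySum_transpose (T : Matrix ι ι (ZMod 8)) : entrySum Tᵀ = entrySum T := by
  rw [entrySum, dotProduct_mulVec, vecMul_transpose, dotProduct_comm, entrySum]

end

section
variable {ι : Type*} [Fintype ι] [DecidableEq ι]

theorem entrySum_diagonal (d : ι → ZMod 8) : entrySum (diagonal d) = ∑ i, d i := by
  simp [entrySum, dotProduct, mulVec_diagonal]

theorem congr_one_add_two_smul (D W : Matrix ι ι (ZMod 8)) :
    (1 + (2 : ZMod 8) • D) * (1 + (2 : ZMod 8) • W) * (1 + (2 : ZMod 8) • D)ᵀ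
      = 1 + (2 : ZMod 8) • W + (2 : ZMod 8) • (D + Dᵀ)
        + (4 : ZMod 8) • (D * W + W * Dᵀ + D * Dᵀ) := by
  rw [← add_zero (_ + (4 : ZMod 8) • _), ← eight_smul_eq_zero (D * W * Dᵀ)]
  simp only [transpose_add, transpose_smul, transpose_one, add_mul, mul_add, smul_mul_assoc,
    mul_smul_comm, one_mul, mul_one, Matrix.mul_assoc]
  module

theorem FormRel.of_one_add_two_smul (T D : Matrix ι ι (ZMod 8)) :
    FormRel T ((1 + (2 : ZMod 8) • D) * T * (1 + (2 : ZMod 8) • D)ᵀ) := by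
  refine FormRel.of_matrix ?_
  have h : (1 + (2 : ZMod 8) • D).map redTwo = 1 := by
    ext i j
    have h2 : redTwo 2 = 0 := rfl
    by_cases hij : i = j
    · subst hij; simp [h2]
    · simp [hij, h2]
  rw [h, transpose_one, Matrix.mul_one]

/-- Congruence by a matrix that is `1` modulo 2 corrects all entries modulo 4, as soon as the
diagonal entries are correct modulo 4. -/
theorem IsOddForm.exists_formRel_mod_four {T T' : Matrix ι ι (ZMod 8)} (hT : IsOddForm T)
    (hT' : IsOddForm T') (hd : ∀ i, 2 * T i i = 2 * T' i i) :
    ∃ T'' E : Matrix ι ι (ZMod 8), FormRel T T'' ∧ Eᵀ = E ∧ T' = T'' + (4 : ZMod 8) • E := by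
  obtain ⟨W, hW, rfl⟩ := hT.exists_eq_one_add
  obtain ⟨W', hW', rfl⟩ := hT'.exists_eq_one_add
  obtain ⟨U, hU⟩ := exists_eq_diagonal_add (Y := W' - W) (by rw [transpose_sub, hW, hW'])
  -- The strictly upper part of the difference corrects the entries off the diagonal modulo 4.
  set T'' := (1 + (2 : ZMod 8) • U) * (1 + (2 : ZMod 8) • W) * (1 + (2 : ZMod 8) • U)ᵀ with hT''
  have hrel : FormRel (1 + (2 : ZMod 8) • W) T'' := FormRel.of_one_add_two_smul _ _
  have hodd := hrel.isOddForm hT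
  have hdiag : (4 : ZMod 8) • diagonal (fun i => (W' - W) i i) = 0 := by
    ext i j
    by_cases hij : i = j
    · subst hij
      have h := hd i
      simp only [Matrix.add_apply, Matrix.smul_apply, one_apply_eq, smul_eq_mul] at h
      simp only [Matrix.smul_apply, diagonal_apply_eq, Matrix.sub_apply, smul_eq_mul,
        Matrix.zero_apply]
      linear_combination -h
    · simp [hij]
  have h2 : (2 : ZMod 8) • (1 + (2 : ZMod 8) • W' - T'') = 0 := by
    have e : (2 : ZMod 8) • (1 + (2 : ZMod 8) • W' - T'')
        = (4 : ZMod 8) • ((W' - W) - (U + Uᵀ))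
          - (8 : ZMod 8) • (U * W + W * Uᵀ + U * Uᵀ) := by
      rw [hT'', congr_one_add_two_smul]
      module
    rw [e, eight_smul_eq_zero, sub_zero, ← hdiag]
    congr 1
    conv_lhs => rw [hU]
    rw [add_sub_cancel_right]
  refine ⟨T'', (1 + (2 : ZMod 8) • W' - T'').map fun x => ((x.val / 4 : ℕ) : ZMod 8), hrel, ?_, ?_⟩
  · rw [← transpose_map, transpose_sub, hT'.transpose_eq, hodd.transpose_eq]
  · rw [← sub_eq_iff_eq_add']
    ext i j
    exact exists_eq_four_mul (congrFun (congrFun h2 i) j)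

/-- The star with centre `i₀` and weights `c`, as a symmetric matrix. -/
def starMatrix (i₀ : ι) (c : ι → ZMod 8) : Matrix ι ι (ZMod 8) :=
  Matrix.of fun i j => if i = i₀ then (if j = i₀ then 0 else c j) else if j = i₀ then c i else 0

/-- Congruence by a matrix that is `1` modulo 2 changes a form by any symmetric multiple of 4 that
does not affect the sum of the entries. The diagonal is corrected by a star, whose row sums may be
prescribed up to their total. -/
theorem IsOddForm.formRel_add_four_smul {T E : Matrix ι ι (ZMod 8)} (hT : IsOddForm T)
    (hE : Eᵀ = E) (hs : 4 * entrySum E = 0) : FormRel T (T + (4 : ZMod 8) • E) := by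
  rcases isEmpty_or_nonempty ι with hι | ⟨⟨i₀⟩⟩
  · have h := FormRel.of_one_add_two_smul T 0
    convert h using 1
    exact Subsingleton.elim _ _
  obtain ⟨W, hW, rfl⟩ := hT.exists_eq_one_add
  set L := starMatrix i₀ (fun i => E i i) with hL
  have hLt : Lᵀ = L := by
    ext i j
    by_cases hi : i = i₀ <;> by_cases hj : j = i₀ <;> simp [hL, starMatrix, hi, hj]
  have hLd : ∀ i, L i i = 0 := fun i => by by_cases hi : i = i₀ <;> simp [hL, starMatrix, hi]
  have hEs : 4 * ∑ i, E i i = 0 := by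
    obtain ⟨U, hU⟩ := exists_eq_diagonal_add hE
    rw [hU, entrySum_add, entrySum_add, entrySum_transpose, entrySum_diagonal] at hs
    have h8 : (8 : ZMod 8) = 0 := rfl
    linear_combination hs - entrySum U * h8
  have hrow : ∀ i, 4 * ∑ k, L i k = 4 * E i i := by
    intro i
    by_cases hi : i = i₀
    · have e : ∑ k, L i k = ∑ k, E k k - E i i := by
        rw [hi, ← Finset.sum_erase_eq_sub (Finset.mem_univ i₀),
          ← Finset.sum_erase Finset.univ (hLd i₀)]
        refine Finset.sum_congr rfl fun k hk => ?_
        simp [hL, starMatrix, Finset.ne_of_mem_erase hk]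
      have h8 : (8 : ZMod 8) = 0 := rfl
      rw [e]
      linear_combination hEs - E i i * h8
    · rw [Finset.sum_eq_single i₀ (fun k _ hk => by simp [hL, starMatrix, hi, hk]) (by simp)]
      simp [hL, starMatrix, hi]
  -- `4 Y` is what the star leaves to be corrected. Its diagonal vanishes, so the congruence by
  -- `1 + 4 U`, with `U` the strictly upper part of `Y`, does the rest.
  set Y := E - L - (L * W + W * L) - L * L with hY
  have hYt : Yᵀ = Y := by
    simp only [hY, transpose_sub, transpose_add, transpose_mul, hE, hLt, hW, add_comm]
  have hYd : (4 : ZMod 8) • diagonal (fun i => Y i i) = 0 := by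
    ext i j
    by_cases hij : i = j
    · subst hij
      have h1 : (W * L) i i = (L * W) i i := by
        rw [← transpose_apply (W * L), transpose_mul, hLt, hW]
      have h2 : 4 * (L * L) i i = 4 * ∑ k, L i k := by
        have h4 : ∀ a : ZMod 8, 4 * (a * a) = 4 * a := by decide
        rw [mul_apply, Finset.mul_sum, Finset.mul_sum]
        refine Finset.sum_congr rfl fun k _ => ?_
        rw [show L k i = L i k from congrFun (congrFun hLt i) k, h4]
      have h8 : (8 : ZMod 8) = 0 := rfl
      simp only [Matrix.smul_apply, diagonal_apply_eq, smul_eq_mul, Matrix.zero_apply, hY,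
        Matrix.sub_apply, Matrix.add_apply, h1, hLd]
      linear_combination -h2 - hrow i - (L * W) i i * h8
    · simp [hij]
  obtain ⟨U, hU⟩ := exists_eq_diagonal_add hYt
  have h4 : (4 : ZMod 8) • (U + Uᵀ) = (4 : ZMod 8) • Y := by
    conv_rhs => rw [hU, smul_add, hYd, zero_add]
  have h := FormRel.of_one_add_two_smul (1 + (2 : ZMod 8) • W) (L + (2 : ZMod 8) • U)
  convert h using 1
  rw [congr_one_add_two_smul]
  have e : (1 + (2 : ZMod 8) • W + (2 : ZMod 8) • (L + (2 : ZMod 8) • U + (L + (2 : ZMod 8) • U)ᵀ)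
      + (4 : ZMod 8) • ((L + (2 : ZMod 8) • U) * W + W * (L + (2 : ZMod 8) • U)ᵀ
        + (L + (2 : ZMod 8) • U) * (L + (2 : ZMod 8) • U)ᵀ))
      = 1 + (2 : ZMod 8) • W + (4 : ZMod 8) • (L + (L * W + W * L) + L * L)
        + (4 : ZMod 8) • (U + Uᵀ) + (8 : ZMod 8) • (U * W + W * Uᵀ + L * Uᵀ + U * L
          + (2 : ZMod 8) • (U * Uᵀ)) := by
    simp only [transpose_add, transpose_smul, hLt, add_mul, mul_add, smul_mul_assoc,
      mul_smul_comm]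
    module
  rw [e, eight_smul_eq_zero, h4, hY]
  module

theorem IsOddForm.formRel_of_minusSet_eq {T T' : Matrix ι ι (ZMod 8)} (hT : IsOddForm T)
    (hT' : IsOddForm T') (hJ : minusSet T = minusSet T') (hs : entrySum T = entrySum T') :
    FormRel T T' := by
  have hd : ∀ i, 2 * T i i = 2 * T' i i := fun i => by
    have h := Finset.ext_iff.mp hJ i
    rw [mem_minusSet, mem_minusSet] at h
    have key : ∀ a b : ZMod 8, redTwo a = 1 → redTwo b = 1 → (2 * a = 6 ↔ 2 * b = 6) →
        2 * a = 2 * b := by decide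
    exact key _ _ (hT.redTwo_diag i) (hT'.redTwo_diag i) h
  obtain ⟨T'', E, hrel, hE, rfl⟩ := hT.exists_formRel_mod_four hT' hd
  refine hrel.trans ((hrel.isOddForm hT).formRel_add_four_smul hE ?_)
  rw [entrySum_add, entrySum_smul, hrel.entrySum_eq hT] at hs
  exact left_eq_add.mp hs

theorem FormRel.submatrix (T : Matrix ι ι (ZMod 8)) (σ : Equiv.Perm ι) :
    FormRel T (T.submatrix σ σ) := by
  have h : T.submatrix σ σ
      = (1 : Matrix ι ι (ZMod 8)).submatrix σ id * T
        * ((1 : Matrix ι ι (ZMod 8)).submatrix σ id)ᵀ := by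
    ext i j
    simp [mul_apply, one_apply]
  rw [h]
  refine FormRel.of_matrix ?_
  ext i j
  simp [mul_apply, one_apply, apply_ite redTwo, eq_comm]

/-- The transvection along the indicator vector of four indices changes the sign modulo 4 of these
four diagonal entries. -/
theorem IsOddForm.exists_formRel_minusSet_sdiff {T : Matrix ι ι (ZMod 8)} (hT : IsOddForm T)
    {s : Finset ι} (hs : s ⊆ minusSet T) (hs4 : s.card = 4) :
    ∃ T', FormRel T T' ∧ minusSet T' = minusSet T \ s := by
  set u : ι → ZMod 8 := fun i => if i ∈ s then 1 else 0 with hu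
  have huu : ∀ i, u i * u i = u i := fun i => by by_cases hi : i ∈ s <;> simp [hu, hi]
  have hred : (1 + vecMulVec u u).map redTwo
      = 1 + vecMulVec (fun i => redTwo (u i)) (fun i => redTwo (u i)) := by
    ext i j
    by_cases hij : i = j <;> simp [hij, vecMulVec_apply]
  have hsum : ∑ i, redTwo (u i) = 0 := by
    rw [← map_sum]
    simp [hu, hs4]
    rfl
  refine ⟨_, FormRel.of_matrix (A := 1 + vecMulVec u u) ?_, ?_⟩
  · rw [hred]
    exact transvection_mul_transpose hsum
  have hQ : 2 * (u ⬝ᵥ T *ᵥ u) = 0 := by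
    obtain ⟨V, hV⟩ := hT.exists_dotProduct_eq
    have h8 : (8 : ZMod 8) = 0 := rfl
    have h6 : ∀ i, 2 * (T i i * (u i * u i)) = if i ∈ s then 6 else 0 := fun i => by
      by_cases hi : i ∈ s
      · simp [hu, hi, mem_minusSet.mp (hs hi)]
      · simp [hu, hi]
    rw [hV, mul_add, Finset.mul_sum]
    simp only [h6]
    rw [Finset.sum_ite_mem, Finset.univ_inter, Finset.sum_const, hs4]
    linear_combination (3 + u ⬝ᵥ V *ᵥ u) * h8
  have hTu : ∀ i, 4 * (T *ᵥ u) i = 4 * u i := by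
    obtain ⟨W, hW, rfl⟩ := hT.exists_eq_one_add
    intro i
    have h8 : (8 : ZMod 8) = 0 := rfl
    rw [add_mulVec, one_mulVec, smul_mulVec]
    simp only [Pi.add_apply, Pi.smul_apply, smul_eq_mul]
    linear_combination ((W *ᵥ u) i) * h8
  have hd : ∀ i, 2 * ((1 + vecMulVec u u) * T * (1 + vecMulVec u u)ᵀ : Matrix ι ι (ZMod 8)) i i
      = 2 * T i i + 4 * u i := by
    intro i
    set e : ι → ZMod 8 := Pi.single i 1 with he
    have hentry : ∀ M : Matrix ι ι (ZMod 8), M i i = e ⬝ᵥ M *ᵥ e := fun M => by simp [he]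
    have hv : (1 + vecMulVec u u)ᵀ *ᵥ e = e + u i • u := by
      rw [transpose_add, transpose_one, transpose_vecMulVec, add_mulVec, one_mulVec,
        vecMulVec_mulVec]
      simp [he]
    have hsymm : u ⬝ᵥ T *ᵥ e = e ⬝ᵥ T *ᵥ u := by
      rw [dotProduct_mulVec, ← mulVec_transpose, hT.transpose_eq, dotProduct_comm]
    have heu : e ⬝ᵥ T *ᵥ u = (T *ᵥ u) i := by simp [he]
    rw [hentry T, hentry ((1 + vecMulVec u u) * T * (1 + vecMulVec u u)ᵀ),
      dotProduct_congr_mulVec, hv]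
    simp only [mulVec_add, mulVec_smul, dotProduct_add, add_dotProduct, dotProduct_smul,
      smul_dotProduct, smul_eq_mul, hsymm, heu]
    linear_combination u i * hTu i + u i * u i * hQ + 4 * huu i
  ext i
  rw [Finset.mem_sdiff, mem_minusSet, mem_minusSet, hd]
  by_cases hi : i ∈ s
  · rw [mem_minusSet.mp (hs hi)]
    simp only [hu, hi, if_true]
    decide
  · simp [hu, hi]

theorem exists_perm_mem_iff {s t : Finset ι} (h : s.card = t.card) :
    ∃ σ : Equiv.Perm ι, ∀ i, σ i ∈ t ↔ i ∈ s := by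
  let e : {i // i ∈ s} ≃ {i // i ∈ t} := Finset.equivOfCardEq h
  refine ⟨e.extendSubtype, fun i => ⟨fun hi => ?_, fun hi => e.extendSubtype_mem i hi⟩⟩
  by_contra hn
  exact e.extendSubtype_not_mem i hn hi

/-- Induction on `k`, removing four indices from the minus set of `T'` at each step. -/
theorem IsOddForm.formRel_of_card_minusSet_le {T : Matrix ι ι (ZMod 8)} (hT : IsOddForm T) (k : ℕ) :
    ∀ T' : Matrix ι ι (ZMod 8), IsOddForm T' → (minusSet T').card = (minusSet T).card + 4 * k →
      entrySum T = entrySum T' → FormRel T T' := by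
  induction k with
  | zero =>
    intro T' hT' hc hs
    obtain ⟨σ, hσ⟩ := exists_perm_mem_iff (s := minusSet T) (t := minusSet T') (by omega)
    have hrel := FormRel.submatrix T' σ
    refine (hT.formRel_of_minusSet_eq (hrel.isOddForm hT') ?_ ?_).trans hrel.symm
    · ext i
      rw [← hσ i, mem_minusSet, mem_minusSet]
      rfl
    · rw [hs, hrel.entrySum_eq hT']
  | succ k ih =>
    intro T' hT' hc hs
    obtain ⟨s, hs1, hs4⟩ := Finset.exists_subset_card_eq
      (show 4 ≤ (minusSet T').card by omega)
    obtain ⟨T'', hrel, hJ⟩ := hT'.exists_formRel_minusSet_sdiff hs1 hs4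
    refine (ih T'' (hrel.isOddForm hT') ?_ ?_).trans hrel.symm
    · rw [hJ, Finset.card_sdiff_of_subset hs1]
      omega
    · rw [hs, hrel.entrySum_eq hT']

/-- The classification of odd forms up to congruence under `orthogonalLift`. -/
theorem IsOddForm.formRel_iff {T T' : Matrix ι ι (ZMod 8)} (hT : IsOddForm T) :
    FormRel T T' ↔ IsOddForm T' ∧ (minusSet T').card ≡ (minusSet T).card [MOD 4] ∧
      entrySum T' = entrySum T := by
  refine ⟨fun h => ⟨h.isOddForm hT, h.card_minusSet_modEq hT, h.entrySum_eq hT⟩, ?_⟩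
  rintro ⟨hT', hc, hs⟩
  rcases le_total (minusSet T).card (minusSet T').card with hle | hle
  · obtain ⟨k, hk⟩ := (Nat.modEq_iff_dvd' hle).mp hc.symm
    exact hT.formRel_of_card_minusSet_le k T' hT' (by omega) hs.symm
  · obtain ⟨k, hk⟩ := (Nat.modEq_iff_dvd' hle).mp hc
    exact (hT'.formRel_of_card_minusSet_le k T hT (by omega) hs).symm

end

/-! ### The size of the orbit -/

section
variable {ι : Type*} [Fintype ι] [DecidableEq ι]

/-- Over each orthogonal matrix over `𝔽₂`, every entry has four lifts to `ℤ/8`, and all choices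
give an invertible matrix. -/
theorem card_orthogonalLift : Nat.card (orthogonalLift ι)
    = 4 ^ (Fintype.card ι ^ 2) * Nat.card (orthogonalGroupTwo ι) := by
  have h4 : Nat.card (ι → ι → Fin 4) = 4 ^ (Fintype.card ι ^ 2) := by
    simp [← pow_mul, sq]
  rw [← h4, ← Nat.card_prod]
  have hlt : ∀ x : ZMod 8, x.val / 2 < 4 := by decide
  have hpair : ∀ x y : ZMod 8, redTwo x = redTwo y → x.val / 2 = y.val / 2 → x = y := by decide
  have hval : ∀ (a : ZMod 2) (b : Fin 4), redTwo ((a.val + 2 * b.val : ℕ) : ZMod 8) = a ∧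
      ((a.val + 2 * b.val : ℕ) : ZMod 8).val / 2 = b.val := by decide
  refine Nat.card_eq_of_bijective (fun g => (fun i j => ⟨(g.1.val i j).val / 2, hlt _⟩,
    ⟨GeneralLinearGroup.map redTwo g.1, g.2⟩)) ⟨?_, ?_⟩
  · intro g h hgh
    obtain ⟨h1, h2⟩ := Prod.ext_iff.mp hgh
    refine Subtype.ext (Units.ext ?_)
    ext i j
    refine hpair _ _ ?_ (Fin.ext_iff.mp (congrFun (congrFun h1 i) j))
    exact congrArg (fun x : orthogonalGroupTwo ι => x.1.val i j) h2
  · rintro ⟨b, h, hh⟩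
    set A : Matrix ι ι (ZMod 8) :=
      Matrix.of fun i j => (((h.val i j).val + 2 * (b i j).val : ℕ) : ZMod 8) with hA
    have hmap : A.map redTwo = h.val := by
      ext i j
      exact (hval _ _).1
    have hAA : A.map redTwo * (A.map redTwo)ᵀ = 1 := by
      rw [hmap]
      exact mem_congrStabilizer_one.mp hh
    obtain ⟨g, hg⟩ := isUnit_of_map_redTwo hAA
    refine ⟨⟨g, mem_orthogonalLift.mpr (by rwa [hg])⟩, Prod.ext ?_ (Subtype.ext (Units.ext ?_))⟩
    · funext i j
      refine Fin.ext ?_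
      change (g.val i j).val / 2 = _
      rw [hg]
      exact (hval _ _).2
    · change g.val.map redTwo = h.val
      rw [hg, hmap]

/-- The orbit-stabilizer relation for the congruence action of `orthogonalLift` on `S`. -/
theorem IsOddForm.card_orbit_mul_card_congrStabilizer {S : Matrix ι ι (ZMod 8)} (hS : IsOddForm S) :
    Nat.card {T // FormRel S T} * Nat.card (congrStabilizer S) = Nat.card (orthogonalLift ι) := by
  have hle : congrStabilizer S ≤ orthogonalLift ι := by
    intro g hg
    have h := congrArg (fun A => A.map redTwo) (mem_congrStabilizer.mp hg)
    simp only [Matrix.map_mul, hS.map_eq, Matrix.mul_one, transpose_map] at h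
    exact mem_orthogonalLift.mpr h
  rw [card_eq_card_range_mul_card_subgroup ((congrStabilizer S).subgroupOf (orthogonalLift ι))
    (fun g => g.1.val * S * g.1.valᵀ), Nat.card_congr (Subgroup.subgroupOfEquivOfLe hle).toEquiv]
  · congr 1
    refine Nat.card_congr (Equiv.subtypeEquivRight fun T => ?_)
    constructor
    · rintro ⟨g, hg, h⟩
      exact ⟨⟨g, hg⟩, h⟩
    · rintro ⟨g, h⟩
      exact ⟨g.1, g.2, h⟩
  · intro g h
    rw [Subgroup.mem_subgroupOf, mem_congrStabilizer, Subgroup.coe_mul, Subgroup.coe_inv,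
      Units.val_mul, transpose_mul]
    have h1 : g.1.valᵀ * (↑g.1⁻¹ : Matrix ι ι (ZMod 8))ᵀ = 1 := by
      rw [← transpose_mul, Units.inv_mul, transpose_one]
    have h2 : (↑g.1⁻¹ : Matrix ι ι (ZMod 8))ᵀ * g.1.valᵀ = 1 := by
      rw [← transpose_mul, Units.mul_inv, transpose_one]
    have e : (↑g.1⁻¹ : Matrix ι ι (ZMod 8)) * h.1.val * S
        * (h.1.valᵀ * (↑g.1⁻¹ : Matrix ι ι (ZMod 8))ᵀ)
        = (↑g.1⁻¹ : Matrix ι ι (ZMod 8)) * (h.1.val * S * h.1.valᵀ)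
          * (↑g.1⁻¹ : Matrix ι ι (ZMod 8))ᵀ := by simp only [Matrix.mul_assoc]
    rw [e]
    constructor
    · intro hgh
      rw [← hgh]
      calc _ = ((↑g.1⁻¹ : Matrix ι ι (ZMod 8)) * g.1.val) * S
            * (g.1.valᵀ * (↑g.1⁻¹ : Matrix ι ι (ZMod 8))ᵀ) := by simp only [Matrix.mul_assoc]
        _ = S := by rw [h1, Units.inv_mul, Matrix.one_mul, Matrix.mul_one]
    · intro hS'
      calc g.1.val * S * g.1.valᵀ
          = (g.1.val * (↑g.1⁻¹ : Matrix ι ι (ZMod 8))) * (h.1.val * S * h.1.valᵀ)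
            * ((↑g.1⁻¹ : Matrix ι ι (ZMod 8))ᵀ * g.1.valᵀ) := by
            conv_lhs => rw [← hS']
            simp only [Matrix.mul_assoc]
        _ = _ := by rw [h2, Units.mul_inv, Matrix.one_mul, Matrix.mul_one]

end

section
variable {ι : Type*} [LinearOrder ι]

/-- The odd form with minus set `J` whose entries carry the bits `b`: a diagonal entry is
determined by its class modulo 4 and one bit, an even entry by two bits, which are stored at the
two positions symmetric to each other. -/
def oddFormOfBits (J : Finset ι) (b : ι → ι → Bool) : Matrix ι ι (ZMod 8) :=
  Matrix.of fun i j =>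
    if i = j then (if i ∈ J then 3 else 1) + 4 * (b i i).toNat
    else 2 * (b (min i j) (max i j)).toNat + 4 * (b (max i j) (min i j)).toNat

theorem isOddForm_oddFormOfBits (J : Finset ι) (b : ι → ι → Bool) :
    IsOddForm (oddFormOfBits J b) := by
  constructor
  · ext i j
    by_cases hij : i = j
    · simp [oddFormOfBits, hij]
    · simp [oddFormOfBits, hij, Ne.symm hij, min_comm i j, max_comm i j]
  · have h4 : redTwo 4 = 0 := rfl
    have h3 : redTwo 3 = 1 := rfl
    have h2 : redTwo 2 = 0 := rfl
    ext i j
    by_cases hij : i = j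
    · subst hij
      by_cases hi : i ∈ J <;> simp [oddFormOfBits, hi, h4, h3]
    · simp [oddFormOfBits, hij, h4, h2]

theorem oddFormOfBits_injective {J : Finset ι} {b b' : ι → ι → Bool}
    (h : oddFormOfBits J b = oddFormOfBits J b') : b = b' := by
  have hd : ∀ (a : ZMod 8) (x x' : Bool),
      a + 4 * (x.toNat : ZMod 8) = a + 4 * x'.toNat → x = x' := by
    decide
  have ho : ∀ x y x' y' : Bool, 2 * (x.toNat : ZMod 8) + 4 * y.toNat = 2 * x'.toNat + 4 * y'.toNat →
      x = x' ∧ y = y' := by decide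
  funext i j
  have hij := congrFun (congrFun h i) j
  simp only [oddFormOfBits, of_apply] at hij
  rcases lt_trichotomy i j with hlt | rfl | hlt
  · rw [if_neg hlt.ne, if_neg hlt.ne, min_eq_left hlt.le, max_eq_right hlt.le] at hij
    exact (ho _ _ _ _ hij).1
  · rw [if_pos rfl, if_pos rfl] at hij
    exact hd _ _ _ hij
  · rw [if_neg hlt.ne', if_neg hlt.ne', min_eq_right hlt.le, max_eq_left hlt.le] at hij
    exact (ho _ _ _ _ hij).2

end

section
variable {ι : Type*} [Fintype ι] [LinearOrder ι]

theorem minusSet_oddFormOfBits (J : Finset ι) (b : ι → ι → Bool) :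
    minusSet (oddFormOfBits J b) = J := by
  ext i
  rw [mem_minusSet]
  by_cases hi : i ∈ J <;> cases h : b i i <;> simp [oddFormOfBits, hi, h] <;> decide

theorem IsOddForm.exists_oddFormOfBits_eq {T : Matrix ι ι (ZMod 8)} (hT : IsOddForm T) :
    ∃ b, oddFormOfBits (minusSet T) b = T := by
  refine ⟨fun i j => if i < j then decide (2 * T i j = 4) else decide (4 ≤ (T i j).val), ?_⟩
  have hd : ∀ x : ZMod 8, redTwo x = 1 →
      (if 2 * x = 6 then 3 else 1) + 4 * ((decide (4 ≤ x.val)).toNat : ZMod 8) = x := by decide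
  have ho : ∀ x : ZMod 8, redTwo x = 0 →
      2 * ((decide (2 * x = 4)).toNat : ZMod 8) + 4 * (decide (4 ≤ x.val)).toNat = x := by decide
  ext i j
  rcases lt_trichotomy i j with hlt | rfl | hlt
  · simp only [oddFormOfBits, of_apply, if_neg hlt.ne, min_eq_left hlt.le, max_eq_right hlt.le,
      if_pos hlt, if_neg hlt.not_gt, hT.apply_comm j i]
    exact ho _ (hT.redTwo_off_diag hlt.ne)
  · simp only [oddFormOfBits, of_apply, if_true, lt_irrefl, if_false, mem_minusSet]
    exact hd _ (hT.redTwo_diag i)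
  · simp only [oddFormOfBits, of_apply, if_neg hlt.ne', min_eq_right hlt.le, max_eq_left hlt.le,
      if_pos hlt, if_neg hlt.not_gt, hT.apply_comm i j]
    exact ho _ (hT.redTwo_off_diag hlt.ne)

/-- The odd forms with a given minus set are as many as the Boolean matrices. -/
theorem card_isOddForm (p : Finset ι → Prop) :
    Nat.card {T : Matrix ι ι (ZMod 8) // IsOddForm T ∧ p (minusSet T)}
      = Nat.card {J : Finset ι // p J} * 2 ^ (Fintype.card ι ^ 2) := by
  have h2 : Nat.card (ι → ι → Bool) = 2 ^ (Fintype.card ι ^ 2) := by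
    simp [← pow_mul, sq]
  rw [← h2, ← Nat.card_prod]
  symm
  refine Nat.card_eq_of_bijective (fun x => ⟨oddFormOfBits x.1.1 x.2,
    isOddForm_oddFormOfBits _ _, by
    rw [minusSet_oddFormOfBits]; exact x.1.2⟩) ⟨?_, ?_⟩
  · rintro ⟨⟨J, hJ⟩, b⟩ ⟨⟨J', hJ'⟩, b'⟩ h
    have h1 : oddFormOfBits J b = oddFormOfBits J' b' := Subtype.ext_iff.mp h
    obtain rfl : J = J' := by
      rw [← minusSet_oddFormOfBits J b, h1, minusSet_oddFormOfBits]
    rw [oddFormOfBits_injective h1]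
  · rintro ⟨T, hT, hp⟩
    obtain ⟨b, hb⟩ := hT.exists_oddFormOfBits_eq
    exact ⟨⟨⟨minusSet T, hp⟩, b⟩, Subtype.ext hb⟩

end

theorem isOddForm_add_single {ι : Type*} [DecidableEq ι] {T : Matrix ι ι (ZMod 8)}
    (hT : IsOddForm T) (i : ι) : IsOddForm (T + Matrix.single i i 4) := by
  refine ⟨by rw [transpose_add, hT.transpose_eq, transpose_single], ?_⟩
  rw [Matrix.map_add _ (map_add redTwo), hT.map_eq, map_single, show redTwo 4 = 0 from rfl,
    single_zero, add_zero]

section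
variable {ι : Type*} [Fintype ι] [DecidableEq ι]

theorem IsOddForm.two_mul_entrySum {T : Matrix ι ι (ZMod 8)} (hT : IsOddForm T) :
    2 * entrySum T = 2 * Fintype.card ι + 4 * (minusSet T).card := by
  obtain ⟨V, hV⟩ := hT.exists_dotProduct_eq
  have h8 : (8 : ZMod 8) = 0 := rfl
  have hd : ∀ i, 2 * T i i = 2 + 4 * if i ∈ minusSet T then 1 else 0 := fun i => by
    have key : ∀ a : ZMod 8, redTwo a = 1 → 2 * a = 2 + 4 * if 2 * a = 6 then 1 else 0 := by decide
    simp only [mem_minusSet]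
    exact key _ (hT.redTwo_diag i)
  have hsum : 2 * ∑ i, T i i = 2 * Fintype.card ι + 4 * (minusSet T).card := by
    rw [Finset.mul_sum]
    simp only [hd, Finset.sum_add_distrib, ← Finset.mul_sum, Finset.sum_const, Finset.card_univ,
      Finset.sum_ite_mem, Finset.univ_inter, nsmul_eq_mul]
    ring
  rw [entrySum, hV]
  simp only [Pi.one_apply, mul_one]
  linear_combination hsum + (1 ⬝ᵥ V *ᵥ 1) * h8

theorem minusSet_add_single (T : Matrix ι ι (ZMod 8)) (i : ι) :
    minusSet (T + Matrix.single i i 4) = minusSet T := by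
  ext k
  rw [mem_minusSet, mem_minusSet, Matrix.add_apply]
  have h8 : (2 * 4 : ZMod 8) = 0 := rfl
  by_cases hk : i = k
  · subst hk; simp [mul_add, h8]
  · simp [hk]

theorem entrySum_add_single (T : Matrix ι ι (ZMod 8)) (i : ι) :
    entrySum (T + Matrix.single i i 4) = entrySum T + 4 := by
  rw [entrySum_add, ← diagonal_single, entrySum_diagonal]
  simp

/-- Prescribing the sum of the entries halves the number of odd forms: the sum is determined
modulo 4 by the minus set, and adding 4 to one diagonal entry changes it by 4. -/
theorem two_mul_card_formRel [Nonempty ι] {S : Matrix ι ι (ZMod 8)} (hS : IsOddForm S) :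
    2 * Nat.card {T // FormRel S T}
      = Nat.card {T : Matrix ι ι (ZMod 8) // IsOddForm T ∧
          (minusSet T).card ≡ (minusSet S).card [MOD 4]} := by
  obtain ⟨i⟩ := ‹Nonempty ι›
  set f : Matrix ι ι (ZMod 8) → Matrix ι ι (ZMod 8) := fun T => T + Matrix.single i i 4
  have hf : Function.Injective f := add_left_injective _
  have hunion : {T | IsOddForm T ∧ (minusSet T).card ≡ (minusSet S).card [MOD 4]}
      = {T | FormRel S T} ∪ f '' {T | FormRel S T} := by
    ext T
    simp only [Set.mem_union, Set.mem_image, Set.mem_ofPred_eq, hS.formRel_iff]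
    constructor
    · rintro ⟨hT, hc⟩
      have h2 : 2 * entrySum T = 2 * entrySum S := by
        have h4 : (4 : ZMod 8) * (minusSet T).card = 4 * (minusSet S).card := by
          have h := (ZMod.natCast_eq_natCast_iff _ _ 8).mpr
            ((hc.of_dvd (show 2 ∣ 4 by norm_num)).mul_left' (c := 4))
          simpa using h
        rw [hT.two_mul_entrySum, hS.two_mul_entrySum, h4]
      have key : ∀ x y : ZMod 8, 2 * x = 2 * y → x = y ∨ x + 4 = y := by decide
      rcases key _ _ h2 with h | h
      · exact Or.inl ⟨hT, hc, h⟩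
      · refine Or.inr ⟨f T, ⟨isOddForm_add_single hT i, ?_, ?_⟩, ?_⟩
        · rwa [minusSet_add_single]
        · rwa [entrySum_add_single]
        · simp only [f]
          rw [add_assoc, ← Matrix.single_add, show (4 + 4 : ZMod 8) = 0 from rfl, single_zero,
            add_zero]
    · rintro (⟨hT, hc, -⟩ | ⟨T, ⟨hT, hc, -⟩, rfl⟩)
      · exact ⟨hT, hc⟩
      · exact ⟨isOddForm_add_single hT i, by rwa [minusSet_add_single]⟩
  have hdisj : Disjoint {T | FormRel S T} (f '' {T | FormRel S T}) := by
    rw [Set.disjoint_left]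
    rintro _ hT ⟨T, hT', rfl⟩
    have h1 := hT.entrySum_eq hS
    rw [entrySum_add_single, FormRel.entrySum_eq hT' hS] at h1
    exact absurd (add_eq_left.mp h1) (by decide)
  change 2 * Nat.card ({T | FormRel S T} : Set _) = Nat.card ({T | _} : Set (Matrix ι ι (ZMod 8)))
  rw [hunion, Nat.card_coe_set_eq, Nat.card_coe_set_eq, Set.ncard_union_eq hdisj,
    Set.ncard_image_of_injective _ hf, two_mul]

end

/-- Orbit-stabilizer for `S`, with the orders of `orthogonalLift` and of the orbit inserted. -/
theorem card_congrStabilizer_mul {m : ℕ} {S : Matrix (Fin (m + 1)) (Fin (m + 1)) (ZMod 8)}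
    (hS : IsOddForm S) :
    Nat.card (congrStabilizer S)
      * Nat.card {J : Finset (Fin (m + 1)) // J.card ≡ (minusSet S).card [MOD 4]}
      = 2 ^ (m ^ 2 + 2 * m + 2) * Nat.card (orthogonalGroupTwo (Fin (m + 1))) := by
  have h1 := hS.card_orbit_mul_card_congrStabilizer
  have h2 := two_mul_card_formRel hS
  rw [card_isOddForm (fun J => J.card ≡ (minusSet S).card [MOD 4])] at h2
  rw [card_orthogonalLift] at h1
  simp only [Fintype.card_fin] at h1 h2
  have h4 : 4 ^ ((m + 1) ^ 2) = 2 ^ ((m + 1) ^ 2) * 2 ^ ((m + 1) ^ 2) := by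
    rw [← mul_pow, show 2 * 2 = 4 from rfl]
  have h5 : 2 ^ (m ^ 2 + 2 * m + 2) = 2 * 2 ^ ((m + 1) ^ 2) := by
    rw [← pow_succ']; congr 1; ring
  rw [h4] at h1
  rw [h5]
  refine Nat.eq_of_mul_eq_mul_left (show 0 < 2 ^ ((m + 1) ^ 2) by positivity) ?_
  calc _ = (Nat.card {J : Finset (Fin (m + 1)) // J.card ≡ (minusSet S).card [MOD 4]}
        * 2 ^ (m + 1) ^ 2) * Nat.card (congrStabilizer S) := by ring
    _ = 2 * (Nat.card {T // FormRel S T} * Nat.card (congrStabilizer S)) := by rw [← h2]; ring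
    _ = _ := by rw [h1]; ring

/-! ### Subsets of prescribed size modulo 4 -/

/-- The number of subsets of `s` with size `≡ r mod 4`. The last term is only there to make the
formula hold for the empty set, where the induction starts. -/
theorem four_mul_sum_powerset {α : Type*} [DecidableEq α] (s : Finset α) :
    ∀ r : ℤ, 4 * ∑ J ∈ s.powerset, (if (J.card : ℤ) ≡ r [ZMOD 4] then (1 : ℝ) else 0)
      = 2 ^ s.card + 2 * √2 ^ s.card * Real.cos ((s.card - 2 * r) * Real.pi / 4)
        + 0 ^ s.card * Real.cos (r * Real.pi) := by
  induction s using Finset.induction_on with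
  | empty =>
    intro r
    obtain ⟨k, hk⟩ : ∃ k : ℤ, r = r % 4 + 4 * k := ⟨r / 4, by omega⟩
    have e1 : Real.cos ((((∅ : Finset α).card : ℕ) - 2 * (r : ℝ)) * Real.pi / 4)
        = Real.cos ((r % 4 : ℤ) * Real.pi / 2) := by
      rw [← Real.cos_neg, ← Real.cos_add_int_mul_two_pi ((r % 4 : ℤ) * Real.pi / 2) k]
      congr 1
      conv_lhs => rw [hk]
      push_cast
      simp
      ring
    have e2 : Real.cos (r * Real.pi) = Real.cos ((r % 4 : ℤ) * Real.pi) := by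
      rw [← Real.cos_add_int_mul_two_pi ((r % 4 : ℤ) * Real.pi) (2 * k)]
      congr 1
      conv_lhs => rw [hk]
      push_cast
      ring
    rw [e1, e2, Finset.powerset_empty, Finset.sum_singleton]
    have hmod : ((∅ : Finset α).card : ℤ) ≡ r [ZMOD 4] ↔ r % 4 = 0 := by
      rw [Finset.card_empty]
      simp [Int.ModEq, eq_comm]
    simp only [hmod]
    have hr : r % 4 = 0 ∨ r % 4 = 1 ∨ r % 4 = 2 ∨ r % 4 = 3 := by omega
    have c3 : Real.cos (3 * Real.pi / 2) = 0 := by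
      rw [show 3 * Real.pi / 2 = Real.pi / 2 + Real.pi by ring, Real.cos_add_pi,
        Real.cos_pi_div_two,
        neg_zero]
    have c3' : Real.cos (3 * Real.pi) = -1 := by
      rw [show 3 * Real.pi = Real.pi + 2 * Real.pi by ring, Real.cos_add_two_pi, Real.cos_pi]
    have c2 : Real.cos (2 * Real.pi / 2) = -1 := by
      rw [show 2 * Real.pi / 2 = Real.pi by ring, Real.cos_pi]
    rcases hr with h | h | h | h <;> rw [h] <;> norm_num [c3, c3', c2]
  | insert a s ha ih =>
    intro r
    rw [Finset.sum_powerset_insert ha, mul_add, ih r]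
    have hstep : ∑ t ∈ s.powerset, (if ((insert a t).card : ℤ) ≡ r [ZMOD 4] then (1 : ℝ) else 0)
        = ∑ t ∈ s.powerset, if (t.card : ℤ) ≡ r - 1 [ZMOD 4] then (1 : ℝ) else 0 := by
      refine Finset.sum_congr rfl fun t ht => ?_
      rw [Finset.card_insert_of_notMem fun h => ha (Finset.mem_powerset.mp ht h)]
      refine if_congr ?_ rfl rfl
      simp only [Int.ModEq]
      push_cast
      omega
    rw [hstep, ih (r - 1), Finset.card_insert_of_notMem ha]
    set θ := ((s.card : ℝ) - 2 * r) * Real.pi / 4 with hθ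
    have t1 : ((s.card : ℝ) - 2 * ((r - 1 : ℤ) : ℝ)) * Real.pi / 4 = θ + Real.pi / 2 := by
      rw [hθ]; push_cast; ring
    have t2 : (((s.card + 1 : ℕ) : ℝ) - 2 * r) * Real.pi / 4 = θ + Real.pi / 4 := by
      rw [hθ]; push_cast; ring
    have t3 : ((r - 1 : ℤ) : ℝ) * Real.pi = r * Real.pi - Real.pi := by push_cast; ring
    rw [t1, t2, t3, Real.cos_add_pi_div_two, Real.cos_add, Real.cos_pi_div_four,
      Real.sin_pi_div_four, Real.cos_sub_pi, pow_succ, pow_succ, pow_succ]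
    have h2 : √2 * √2 = (2 : ℝ) := Real.mul_self_sqrt (by norm_num)
    linear_combination (-√2 ^ s.card * (Real.cos θ - Real.sin θ)) * h2

theorem four_mul_card_finset (m r : ℕ) :
    4 * (Nat.card {J : Finset (Fin (m + 1)) // J.card ≡ r [MOD 4]} : ℝ)
      = 2 ^ (m + 1) + 2 * √2 ^ (m + 1) * Real.cos (((m : ℝ) + 1 - 2 * r) * Real.pi / 4) := by
  have h := four_mul_sum_powerset (Finset.univ : Finset (Fin (m + 1))) r
  rw [Finset.sum_boole, Finset.powerset_univ, Finset.card_univ, Fintype.card_fin] at h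
  rw [Nat.card_eq_fintype_card, Fintype.card_subtype]
  have hiff : ∀ J : Finset (Fin (m + 1)), (J.card : ℤ) ≡ r [ZMOD 4] ↔ J.card ≡ r [MOD 4] :=
    fun J => Int.natCast_modEq_iff (n := 4)
  simp only [hiff] at h
  rw [h]
  push_cast
  ring

theorem betaFun_eq (n : ℕ) : betaFun ((n : ℝ) + 1)
    = Nat.card {J : Finset (Fin (n + 1)) // J.card ≡ 0 [MOD 4]} := by
  have h := four_mul_card_finset n 0
  have h1 : (2 : ℝ) ^ ((n : ℝ) + 1 - 2) = 2 ^ (n + 1) / 4 := by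
    rw [Real.rpow_sub two_pos, ← Nat.cast_succ, Real.rpow_natCast]; norm_num
  have h2 : (2 : ℝ) ^ (((n : ℝ) + 1 - 2) / 2) = √2 ^ (n + 1) / 2 := by
    rw [show ((n : ℝ) + 1 - 2) / 2 = 1 / 2 * ((n + 1 : ℕ) : ℝ) - 1 by push_cast; ring,
      Real.rpow_sub two_pos, Real.rpow_mul two_pos.le, ← Real.sqrt_eq_rpow, Real.rpow_natCast,
      Real.rpow_one]
  rw [betaFun, h1, h2]
  push_cast at h
  rw [mul_zero, sub_zero] at h
  linarith

theorem gammaFun_eq (n : ℕ) : gammaFun ((n : ℝ) - 1)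
    = Nat.card {J : Finset (Fin (n + 1)) // J.card ≡ 1 [MOD 4]} := by
  have h := four_mul_card_finset n 1
  have h1 : (2 : ℝ) ^ ((n : ℝ) - 1) = 2 ^ (n + 1) / 4 := by
    rw [show (n : ℝ) - 1 = ((n + 1 : ℕ) : ℝ) - 2 by push_cast; ring, Real.rpow_sub two_pos,
      Real.rpow_natCast]; norm_num
  have h2 : (2 : ℝ) ^ (((n : ℝ) - 1) / 2) = √2 ^ (n + 1) / 2 := by
    rw [show ((n : ℝ) - 1) / 2 = 1 / 2 * ((n + 1 : ℕ) : ℝ) - 1 by push_cast; ring,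
      Real.rpow_sub two_pos, Real.rpow_mul two_pos.le, ← Real.sqrt_eq_rpow, Real.rpow_natCast,
      Real.rpow_one]
  rw [gammaFun, h1, h2]
  push_cast at h
  rw [show (n : ℝ) + 1 - 2 * 1 = n - 1 by ring] at h
  linarith

/-! ### The form `x₁² + ⋯ + xₙ² - d xₙ₊₁²` -/

theorem formMatrix_map (n d : ℕ) :
    (formMatrix n d).map (fun x : ℤ => (x : ZMod 8))
      = diagonal fun i => if i = Fin.last n then -(d : ZMod 8) else 1 := by
  rw [formMatrix, diagonal_map Int.cast_zero]
  congr 1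
  funext i
  split_ifs <;> simp

theorem isOddForm_formMatrix {n d : ℕ} (hd : Odd d) :
    IsOddForm ((formMatrix n d).map (fun x : ℤ => (x : ZMod 8))) := by
  rw [formMatrix_map]
  refine ⟨diagonal_transpose _, ?_⟩
  rw [diagonal_map (map_zero _), ← diagonal_one]
  congr 1
  funext i
  have h : redTwo (d : ZMod 8) = 1 := by
    rw [map_natCast]; exact ZMod.natCast_eq_one_iff_odd.mpr hd
  have h' : -redTwo (d : ZMod 8) = 1 := by rw [h]; rfl
  split_ifs
  · exact (map_neg _ _).trans h'
  · exact map_one _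

theorem unitCount_mul_card {n d : ℕ} (hd : Odd d) :
    (unitCount 8 (formMatrix n d) : ℝ) * Nat.card {J : Finset (Fin (n + 1)) //
      J.card ≡ (minusSet ((formMatrix n d).map (fun x : ℤ => (x : ZMod 8)))).card [MOD 4]}
      = 2 ^ (n ^ 2 + 2 * n + 2) * alphaProd n := by
  have hS := isOddForm_formMatrix (n := n) hd
  have hunit : IsUnit ((formMatrix n d).map (fun x : ℤ => (x : ZMod 8))).det := by
    refine (isUnit_iff_isUnit_det _).mp (isUnit_of_map_redTwo ?_)
    rw [hS.map_eq, transpose_one, Matrix.mul_one]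
  rw [unitCount, card_transpose_mul_mul_eq hunit, ← card_orthogonal_zmod_two]
  exact_mod_cast card_congrStabilizer_mul hS

theorem card_finset_ne_zero {n r : ℕ} (hr : r ≤ n + 1) :
    (Nat.card {J : Finset (Fin (n + 1)) // J.card ≡ r [MOD 4]} : ℝ) ≠ 0 := by
  obtain ⟨J, -, hJ⟩ := Finset.exists_subset_card_eq
    (show r ≤ (Finset.univ : Finset (Fin (n + 1))).card by simpa using hr)
  have : Nonempty {J : Finset (Fin (n + 1)) // J.card ≡ r [MOD 4]} := ⟨⟨J, by rw [hJ]⟩⟩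
  exact_mod_cast Nat.card_pos.ne'

theorem two_mul_diag_formMatrix (n d : ℕ) (i : Fin (n + 1)) :
    2 * ((formMatrix n d).map (fun x : ℤ => (x : ZMod 8))) i i
      = if i = Fin.last n then ((-2 * d : ℤ) : ZMod 8) else 2 := by
  rw [formMatrix_map, diagonal_apply_eq]
  split_ifs <;> simp

theorem minusSet_formMatrix_of_modEq_neg_one {n d : ℕ} (hd : (d : ℤ) ≡ -1 [ZMOD 4]) :
    minusSet ((formMatrix n d).map (fun x : ℤ => (x : ZMod 8))) = ∅ := by
  have h2 : ((-2 * d : ℤ) : ZMod 8) = ((2 : ℤ) : ZMod 8) :=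
    (ZMod.intCast_eq_intCast_iff _ _ 8).mpr (by simpa using hd.mul_left' (c := -2))
  ext i
  rw [mem_minusSet, two_mul_diag_formMatrix, h2, Int.cast_ofNat, ite_self]
  simp only [Finset.notMem_empty, iff_false]
  decide

theorem minusSet_formMatrix_of_modEq_one {n d : ℕ} (hd : (d : ℤ) ≡ 1 [ZMOD 4]) :
    minusSet ((formMatrix n d).map (fun x : ℤ => (x : ZMod 8))) = {Fin.last n} := by
  have h2 : ((-2 * d : ℤ) : ZMod 8) = ((-2 : ℤ) : ZMod 8) :=
    (ZMod.intCast_eq_intCast_iff _ _ 8).mpr (by simpa using hd.mul_left' (c := -2))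
  ext i
  rw [mem_minusSet, two_mul_diag_formMatrix, h2, Finset.mem_singleton]
  by_cases hi : i = Fin.last n
  · simp only [hi, if_true, iff_true]; rfl
  · simp only [hi, if_false, iff_false]; decide

theorem theorem1 (n d : ℕ) (hn : 2 ≤ n) (hd_pos : 0 < d) (hd_odd : Odd d)
    (hd_sqf : Squarefree d) :
    ((d : ℤ) ≡ -1 [ZMOD 4] →
      (unitCount 8 (formMatrix n d) : ℝ) =
        (2 : ℝ) ^ (n ^ 2 + 2 * n + 2) * alphaProd n / betaFun ((n : ℝ) + 1)) ∧
    ((d : ℤ) ≡ 1 [ZMOD 4] →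
      (unitCount 8 (formMatrix n d) : ℝ) =
        (2 : ℝ) ^ (n ^ 2 + 2 * n + 2) * alphaProd n / gammaFun ((n : ℝ) - 1)) := by
  have h := unitCount_mul_card (n := n) hd_odd
  constructor
  · intro hd
    rw [minusSet_formMatrix_of_modEq_neg_one hd, Finset.card_empty] at h
    rw [betaFun_eq, eq_div_iff (card_finset_ne_zero (by omega)), h]
  · intro hd
    rw [minusSet_formMatrix_of_modEq_one hd, Finset.card_singleton] at h
    rw [gammaFun_eq, eq_div_iff (card_finset_ne_zero (by omega)), h]
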